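/- Let $\mathcal{A}$ be an additive category and $\mathcal{E}$ an exact structure on $\mathcal{A}$ in the sense of Quillen, that is, a class of kernel–cokernel pairs $(\mu,\pi)$, closed under isomorphisms, such that, calling the first components $\mu$ admissible monomorphisms ($\rightarrowtail$) and the second components $\pi$ admissible epimorphisms ($\twoheadrightarrow$): identities are admissible monomorphisms and admissible epimorphisms; each of the two classes is closed under composition; pushouts of admissible monomorphisms along arbitrary morphisms exist and are admissible monomorphisms; pullbacks of admissible epimorphisms along arbitrary morphisms exist and are admissible epimorphisms. Call an object $I$ injective if every morphism $E\to I$ extends along every admissible monomorphism $E\rightarrowtail F$. Suppose that $\mathcal{A}$ has enough injectives: every object $E$ admits an admissible monomorphism $E\rightarrowtail I$ with $I$ injective. A sequence of morphisms $f_1,f_2,\dots$ with $f_i\colon E_i\to E_{i+1}$ is called an exact sequence of admissible morphisms if each $f_i$ factors as $f_i=\iota_i\pi_i$ with $\pi_i$ an admissible epimorphism and $\iota_i$ an admissible monomorphism such that $(\iota_i,\pi_{i+1})\in\mathcal{E}$ for all consecutive $f_i,f_{i+1}$. Then, for every integer $n\ge 1$ and every object $E$ of $\mathcal{A}$, the following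 are equivalent. (i) Whenever $$E\rightarrowtail I^0\to\cdots\to I^{n-1}\twoheadrightarrow F$$ is an exact sequence of admissible morphisms, beginning with an admissible monomorphism and ending with an admissible epimorphism, in which $I^0,\dots,I^{n-1}$ are injective, the object $F$ is injective. (ii) There is an exact sequence of admissible morphisms $$E\rightarrowtail I^0\to\cdots\to I^{n-1}\twoheadrightarrow I^n,$$ beginning with an admissible monomorphism and ending with an admissible epimorphism, in which $I^0,\dots,I^n$ are injective. -/

import Mathlib

open CategoryTheory CategoryTheory.Limits

universe v u

namespace ExactCat

variable {C : Type u} [Category.{v} C] [Preadditive C]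

/-- The composable pair `K ⟶ E ⟶ Q` given by `μ` and `π` belongs to the class `Ex`
(classes of composable pairs with zero composition are encoded as object properties of
`ShortComplex C`). -/
def InClass (Ex : ObjectProperty (ShortComplex C)) {K E Q : C} (μ : K ⟶ E) (π : E ⟶ Q) : Prop :=
  ∃ w : μ ≫ π = 0, Ex (ShortComplex.mk μ π w)

/-- The class of admissible monomorphisms: first components of pairs in `Ex`. -/
def admissibleMono (Ex : ObjectProperty (ShortComplex C)) : MorphismProperty C :=
  fun _ E μ => ∃ (Q : C) (π : E ⟶ Q), InClass Ex μ π

/-- The class of admissible epimorphisms: second components of pairs in `Ex`. -/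
def admissibleEpi (Ex : ObjectProperty (ShortComplex C)) : MorphismProperty C :=
  fun E _ π => ∃ (K : C) (μ : K ⟶ E), InClass Ex μ π

/-- `T` is a kernel-cokernel pair: `T.f` is a kernel of `T.g` and `T.g` is a cokernel of `T.f`. -/
def IsKernelCokernelPair (T : ShortComplex C) : Prop :=
  Nonempty (IsLimit (KernelFork.ofι T.f T.zero)) ∧
    Nonempty (IsColimit (CokernelCofork.ofπ T.g T.zero))

/-- `Ex` is an exact structure (in the sense of Quillen): a class of kernel-cokernel pairs, closed
under isomorphisms, satisfying [E0], [E0ᵒᵖ], [E1], [E1ᵒᵖ], [E2], [E2ᵒᵖ]. -/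
structure IsExactStructure (Ex : ObjectProperty (ShortComplex C)) : Prop where
  isKernelCokernelPair : ∀ T : ShortComplex C, Ex T → IsKernelCokernelPair T
  of_iso : ∀ {T T' : ShortComplex C}, (T ≅ T') → Ex T → Ex T'
  id_mono : ∀ E : C, admissibleMono Ex (𝟙 E)
  id_epi : ∀ E : C, admissibleEpi Ex (𝟙 E)
  comp_mono : ∀ {E F G : C} (f : E ⟶ F) (g : F ⟶ G),
    admissibleMono Ex f → admissibleMono Ex g → admissibleMono Ex (f ≫ g)
  comp_epi : ∀ {E F G : C} (f : E ⟶ F) (g : F ⟶ G),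
    admissibleEpi Ex f → admissibleEpi Ex g → admissibleEpi Ex (f ≫ g)
  pushout_mono : ∀ {E F E' : C} (f : E ⟶ F) (g : E ⟶ E'), admissibleMono Ex f →
    ∃ (F' : C) (g' : F ⟶ F') (f' : E' ⟶ F'), IsPushout f g g' f' ∧ admissibleMono Ex f'
  pullback_epi : ∀ {E F F' : C} (f : E ⟶ F) (g : F' ⟶ F), admissibleEpi Ex f →
    ∃ (E' : C) (f' : E' ⟶ F') (g' : E' ⟶ E), IsPullback f' g' g f ∧ admissibleEpi Ex f'

/-- `I` is `M`-injective: every morphism to `I` extends along every morphism in `M`. -/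
def IsInjectiveFor (M : MorphismProperty C) (I : C) : Prop :=
  ∀ {E F : C} (μ : E ⟶ F), M μ → ∀ f : E ⟶ I, ∃ g : F ⟶ I, μ ≫ g = f

/-- Every object is the source of a morphism in `M` with `M`-injective target. -/
def HasEnoughInjectivesFor (M : MorphismProperty C) : Prop :=
  ∀ E : C, ∃ I : C, IsInjectiveFor M I ∧ ∃ μ : E ⟶ I, M μ

/-- The finite sequence `X 0 ⟶ X 1 ⟶ ⋯ ⟶ X (n + 1)` with maps `d` is an exact sequence of admissible
morphisms: each `d i` factors as an admissible epimorphism `π i` followed by an admissible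
monomorphism `ι i`, and the pair `(ι i, π (i + 1))` is in `Ex` at each of the intermediate objects
`X 1, …, X n`. -/
def IsExactSequence (Ex : ObjectProperty (ShortComplex C)) {n : ℕ} (X : Fin (n + 2) → C)
    (d : ∀ i : Fin (n + 1), X i.castSucc ⟶ X i.succ) : Prop :=
  ∃ (G : Fin (n + 1) → C) (π : ∀ i : Fin (n + 1), X i.castSucc ⟶ G i)
    (ι : ∀ i : Fin (n + 1), G i ⟶ X i.succ),
    (∀ i, admissibleEpi Ex (π i)) ∧ (∀ i, admissibleMono Ex (ι i)) ∧
    (∀ i, d i = π i ≫ ι i) ∧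
    ∀ i : Fin n, InClass Ex (ι i.castSucc) (π i.succ)

/-- `X 0 ↣ X 1 ⟶ ⋯ ⟶ X n ↠ X (n + 1)` is an exact sequence of admissible morphisms whose first
morphism is an admissible monomorphism and whose last morphism is an admissible epimorphism. -/
def IsBoundedExactSequence (Ex : ObjectProperty (ShortComplex C)) {n : ℕ} (X : Fin (n + 2) → C)
    (d : ∀ i : Fin (n + 1), X i.castSucc ⟶ X i.succ) : Prop :=
  IsExactSequence Ex X d ∧ admissibleMono Ex (d 0) ∧ admissibleEpi Ex (d (Fin.last n))

end ExactCat

namespace ExactCat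

variable {C : Type u} [Category.{v} C] [Preadditive C] {Ex : ObjectProperty (ShortComplex C)}

/-! Dimension shifting without Ext. Two injective coresolutions of the same object have cosyzygies
that agree modulo maps through injectives. Only one half of this is needed: `IsStableRetract`
relates the initial objects, passes to cosyzygies (`IsStableRetract.cosyzygy`) and carries
injectivity back from the second object to the first. Induction along the two sequences gives (ii) ⇒
(i); for (i) ⇒ (ii), enough injectives provide a sequence to which (i) applies. -/

theorem InClass.mono (hEx : IsExactStructure Ex) {K E Q : C} {μ : K ⟶ E} {π : E ⟶ Q}
    (h : InClass Ex μ π) : Mono μ := by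
  obtain ⟨w, h⟩ := h
  obtain ⟨⟨hl⟩, -⟩ := hEx.isKernelCokernelPair _ h
  exact mono_of_isLimit_fork hl

theorem InClass.epi (hEx : IsExactStructure Ex) {K E Q : C} {μ : K ⟶ E} {π : E ⟶ Q}
    (h : InClass Ex μ π) : Epi π := by
  obtain ⟨w, h⟩ := h
  obtain ⟨-, ⟨hc⟩⟩ := hEx.isKernelCokernelPair _ h
  exact epi_of_isColimit_cofork hc

theorem InClass.exists_lift (hEx : IsExactStructure Ex) {K E Q : C} {μ : K ⟶ E} {π : E ⟶ Q}
    (h : InClass Ex μ π) {A : C} (f : A ⟶ E) (hf : f ≫ π = 0) : ∃ g : A ⟶ K, g ≫ μ = f := by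
  obtain ⟨w, h⟩ := h
  obtain ⟨⟨hl⟩, -⟩ := hEx.isKernelCokernelPair _ h
  exact ⟨_, (KernelFork.IsLimit.lift' hl f hf).2⟩

theorem InClass.exists_desc (hEx : IsExactStructure Ex) {K E Q : C} {μ : K ⟶ E} {π : E ⟶ Q}
    (h : InClass Ex μ π) {A : C} (f : E ⟶ A) (hf : μ ≫ f = 0) : ∃ g : Q ⟶ A, π ≫ g = f := by
  obtain ⟨w, h⟩ := h
  obtain ⟨-, ⟨hc⟩⟩ := hEx.isKernelCokernelPair _ h
  exact ⟨_, (CokernelCofork.IsColimit.desc' hc f hf).2⟩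

theorem isIso_of_admissibleEpi_of_mono (hEx : IsExactStructure Ex) {E Q : C} {π : E ⟶ Q}
    (h : admissibleEpi Ex π) [Mono π] : IsIso π := by
  obtain ⟨K, μ, h⟩ := h
  have := h.epi hEx
  have hμ : μ = 0 := by rw [← cancel_mono π, h.1, zero_comp]
  obtain ⟨r, hr⟩ := h.exists_desc hEx (𝟙 E) (by rw [hμ, zero_comp])
  exact ⟨r, hr, by rw [← cancel_epi π, reassoc_of% hr, Category.comp_id]⟩

theorem isIso_of_admissibleMono_of_epi (hEx : IsExactStructure Ex) {K E : C} {μ : K ⟶ E}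
    (h : admissibleMono Ex μ) [Epi μ] : IsIso μ := by
  obtain ⟨Q, π, h⟩ := h
  have := h.mono hEx
  have hπ : π = 0 := by rw [← cancel_epi μ, h.1, comp_zero]
  obtain ⟨r, hr⟩ := h.exists_lift hEx (𝟙 E) (by rw [hπ, comp_zero])
  exact ⟨r, by rw [← cancel_mono μ, Category.assoc, hr, Category.comp_id, Category.id_comp], hr⟩

/-- Used to identify the image of the first map of a bounded sequence with its source; the dual
below identifies the image of the last map with its target. -/
theorem isIso_of_admissibleMono_comp (hEx : IsExactStructure Ex) {E G F : C} {π : E ⟶ G}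
    {ι : G ⟶ F} (h : admissibleMono Ex (π ≫ ι)) (hπ : admissibleEpi Ex π) : IsIso π := by
  obtain ⟨_, _, h⟩ := h
  have := h.mono hEx
  have := mono_of_mono π ι
  exact isIso_of_admissibleEpi_of_mono hEx hπ

theorem isIso_of_admissibleEpi_comp (hEx : IsExactStructure Ex) {E G F : C} {π : E ⟶ G}
    {ι : G ⟶ F} (h : admissibleEpi Ex (π ≫ ι)) (hι : admissibleMono Ex ι) : IsIso ι := by
  obtain ⟨_, _, h⟩ := h
  have := h.epi hEx
  have := epi_of_epi π ι
  exact isIso_of_admissibleMono_of_epi hEx hι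

/-- `E` is a retract of `E'` up to morphisms factoring through an `M`-injective object. -/
def IsStableRetract (M : MorphismProperty C) (E E' : C) : Prop :=
  ∃ (a : E ⟶ E') (b : E' ⟶ E) (J : C) (s : E ⟶ J) (t : J ⟶ E),
    IsInjectiveFor M J ∧ 𝟙 E = a ≫ b + s ≫ t

theorem IsStableRetract.of_iso {M : MorphismProperty C} (hM : HasEnoughInjectivesFor M) {E E' : C}
    (e : E ≅ E') : IsStableRetract M E E' := by
  obtain ⟨J, hJ, -⟩ := hM E
  exact ⟨e.hom, e.inv, J, 0, 0, hJ, by simp⟩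

theorem IsStableRetract.isInjectiveFor {M : MorphismProperty C} {E E' : C}
    (h : IsStableRetract M E E') (hE' : IsInjectiveFor M E') : IsInjectiveFor M E := by
  obtain ⟨a, b, J, s, t, hJ, hid⟩ := h
  intro A B μ hμ f
  obtain ⟨g₁, hg₁⟩ := hE' μ hμ (f ≫ a)
  obtain ⟨g₂, hg₂⟩ := hJ μ hμ (f ≫ s)
  refine ⟨g₁ ≫ b + g₂ ≫ t, ?_⟩
  rw [Preadditive.comp_add, reassoc_of% hg₁, reassoc_of% hg₂, ← Preadditive.comp_add, ← hid,
    Category.comp_id]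

/-- Stable retracts pass to cosyzygies. -/
theorem IsStableRetract.cosyzygy (hEx : IsExactStructure Ex) {E E' I I' G G' : C}
    {μ : E ⟶ I} {π : I ⟶ G} {μ' : E' ⟶ I'} {π' : I' ⟶ G'}
    (h : IsStableRetract (admissibleMono Ex) E E') (hG : InClass Ex μ π) (hG' : InClass Ex μ' π')
    (hI : IsInjectiveFor (admissibleMono Ex) I) (hI' : IsInjectiveFor (admissibleMono Ex) I') :
    IsStableRetract (admissibleMono Ex) G G' := by
  obtain ⟨a, b, J, s, t, hJ, hid⟩ := h
  have hμ : admissibleMono Ex μ := ⟨_, _, hG⟩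
  obtain ⟨α, hα⟩ := hI' μ hμ (a ≫ μ')
  obtain ⟨β, hβ⟩ := hI μ' ⟨_, _, hG'⟩ (b ≫ μ)
  obtain ⟨σ, hσ⟩ := hJ μ hμ s
  obtain ⟨a', ha'⟩ := hG.exists_desc hEx (α ≫ π') (by
    rw [reassoc_of% hα, hG'.1, comp_zero])
  obtain ⟨b', hb'⟩ := hG'.exists_desc hEx (β ≫ π) (by
    rw [reassoc_of% hβ, hG.1, comp_zero])
  obtain ⟨k, hk⟩ := hG.exists_desc hEx (𝟙 I - α ≫ β - σ ≫ t ≫ μ) (by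
    have := congr($hid ≫ μ)
    simp only [Preadditive.add_comp, Category.assoc, Category.id_comp] at this
    simp only [Preadditive.comp_sub, Category.comp_id, reassoc_of% hα, reassoc_of% hσ, hβ]
    rw [sub_sub, ← this, sub_self])
  have := hG.epi hEx
  refine ⟨a', b', I, k, π, hI, ?_⟩
  rw [← cancel_epi π, Preadditive.comp_add, reassoc_of% ha', hb', reassoc_of% hk]
  simp [Preadditive.sub_comp, hG.1]

/-- If some bounded exact sequence starting at `X 0` has injective middle terms and an injective
final term, then every such sequence of the same length with injective middle terms has an
injective final term. -/
theorem IsBoundedExactSequence.isInjectiveFor_last (hEx : IsExactStructure Ex)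
    (hM : HasEnoughInjectivesFor (admissibleMono Ex)) {n : ℕ} {X X' : Fin (n + 2) → C}
    {d : ∀ i : Fin (n + 1), X i.castSucc ⟶ X i.succ}
    {d' : ∀ i : Fin (n + 1), X' i.castSucc ⟶ X' i.succ}
    (h : IsBoundedExactSequence Ex X d) (h' : IsBoundedExactSequence Ex X' d') (h₀ : X 0 = X' 0)
    (hX : ∀ m : Fin n, IsInjectiveFor (admissibleMono Ex) (X m.castSucc.succ))
    (hX' : ∀ m : Fin (n + 1), IsInjectiveFor (admissibleMono Ex) (X' m.succ)) :
    IsInjectiveFor (admissibleMono Ex) (X (Fin.last (n + 1))) := by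
  obtain ⟨⟨G, π, ι, hπ, hι, hf, hG⟩, hd₀, hd₁⟩ := h
  obtain ⟨⟨G', π', ι', hπ', hι', hf', hG'⟩, hd₀', hd₁'⟩ := h'
  rw [hf] at hd₀ hd₁
  rw [hf'] at hd₀' hd₁'
  have i₀ := isIso_of_admissibleMono_comp hEx hd₀ (hπ 0)
  have i₀' := isIso_of_admissibleMono_comp hEx hd₀' (hπ' 0)
  have := isIso_of_admissibleEpi_comp hEx hd₁ (hι _)
  have := isIso_of_admissibleEpi_comp hEx hd₁' (hι' _)
  have e₀ : X 0 ≅ G 0 := @asIso _ _ _ _ (π 0) i₀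
  have e₀' : X' 0 ≅ G' 0 := @asIso _ _ _ _ (π' 0) i₀'
  -- `G i` and `G' i` are the `i`-th cosyzygies, starting from `G 0 ≅ X 0 = X' 0 ≅ G' 0`.
  have key (i : Fin (n + 1)) : IsStableRetract (admissibleMono Ex) (G i) (G' i) := by
    induction i using Fin.induction with
    | zero => exact .of_iso hM (e₀.symm ≪≫ eqToIso h₀ ≪≫ e₀')
    | succ i ih => exact ih.cosyzygy hEx (hG i) (hG' i) (hX i) (hX' i.castSucc)
  have hG'n : IsInjectiveFor (admissibleMono Ex) (G' (Fin.last n)) :=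
    (IsStableRetract.of_iso hM (asIso (ι' (Fin.last n)))).isInjectiveFor (hX' _)
  have e₁ : X (Fin.last (n + 1)) ≅ G (Fin.last n) := (asIso (ι (Fin.last n))).symm
  have hGn : IsInjectiveFor (admissibleMono Ex) (G (Fin.last n)) := (key _).isInjectiveFor hG'n
  intro A B
  exact (IsStableRetract.of_iso hM e₁).isInjectiveFor hGn

/-- With enough injectives, every object is the initial term of a bounded exact sequence of any
given length with injective middle terms. -/
theorem exists_isBoundedExactSequence (hEx : IsExactStructure Ex)
    (hM : HasEnoughInjectivesFor (admissibleMono Ex)) (n : ℕ) (E : C) :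
    ∃ (X : Fin (n + 2) → C) (d : ∀ i : Fin (n + 1), X i.castSucc ⟶ X i.succ),
      X 0 = E ∧ IsBoundedExactSequence Ex X d ∧
      ∀ m : Fin n, IsInjectiveFor (admissibleMono Ex) (X m.castSucc.succ) := by
  have hex (A : C) : ∃ (I Q : C) (μ : A ⟶ I) (π : I ⟶ Q),
      IsInjectiveFor (admissibleMono Ex) I ∧ InClass Ex μ π := by
    obtain ⟨I, hI, μ, Q, π, h⟩ := hM A
    exact ⟨I, Q, μ, π, hI, h⟩
  choose J Q j q hJ hjq using hex
  let Z (k : ℕ) : C := Q^[k] E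
  have hZ (k : ℕ) : Z (k + 1) = Q (Z k) := Function.iterate_succ_apply' ..
  -- `W i` becomes the term `X (i + 1)`: an injective hull-like object `J (Z i)` for `i < n`, but `Z
  -- n` itself with `ι = 𝟙` at `i = n`, so that the last map is an admissible epimorphism.
  have hW (i : Fin (n + 1)) : ∃ (W : C) (ι : Z i ⟶ W), admissibleMono Ex ι ∧
      (i.val < n → IsInjectiveFor (admissibleMono Ex) W ∧
        ∃ π : W ⟶ Z (i + 1), InClass Ex ι π) ∧
      (i.val = n → admissibleEpi Ex ι) := by
    by_cases hi : i.val = n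
    · exact ⟨_, 𝟙 _, hEx.id_mono _, fun h => by omega, fun _ => hEx.id_epi _⟩
    · rw [hZ]
      exact ⟨_, j _, ⟨_, _, hjq _⟩, fun _ => ⟨hJ _, _, hjq _⟩, fun h => absurd h hi⟩
  choose W ι hι hlt hlast using hW
  have hπ (i : Fin n) : ∃ π : W i.castSucc ⟶ Z i.succ, InClass Ex (ι i.castSucc) π :=
    (hlt i.castSucc i.isLt).2
  choose π hπ using hπ
  let X : Fin (n + 2) → C := Fin.cases E W
  -- The epimorphic part of the first map is `𝟙 E`, which keeps that map an admissible monomorphism.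
  let p : ∀ i : Fin (n + 1), X i.castSucc ⟶ Z i :=
    Fin.cases (motive := fun i => X i.castSucc ⟶ Z i) (𝟙 E) π
  have hp (i : Fin (n + 1)) : admissibleEpi Ex (p i) := by
    cases i using Fin.cases with
    | zero => exact hEx.id_epi E
    | succ i => exact ⟨_, _, hπ i⟩
  refine ⟨X, fun i => p i ≫ ι i, rfl,
    ⟨⟨fun i => Z i, p, ι, hp, hι, fun _ => rfl, hπ⟩, ?_, ?_⟩, fun m => (hlt m.castSucc m.isLt).1⟩
  · exact hEx.comp_mono _ _ (hEx.id_mono E) (hι 0)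
  · exact hEx.comp_epi _ _ (hp _) (hlast _ rfl)

end ExactCat

theorem mainTheorem10 {C : Type u} [Category.{v} C] [Preadditive C] [HasZeroObject C]
    [HasBinaryBiproducts C] (Ex : ObjectProperty (ShortComplex C))
    (hEx : ExactCat.IsExactStructure Ex)
    (hinj : ExactCat.HasEnoughInjectivesFor (ExactCat.admissibleMono Ex))
    (n : ℕ) (hn : 1 ≤ n) (E : C) :
    -- every `E ↣ I⁰ ⟶ ⋯ ⟶ Iⁿ⁻¹ ↠ F` with injective `Iᵐ = X (m + 1)` has `F = X (n + 1)` injective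
    (∀ (X : Fin (n + 2) → C) (d : ∀ i : Fin (n + 1), X i.castSucc ⟶ X i.succ),
      X 0 = E → ExactCat.IsBoundedExactSequence Ex X d →
      (∀ m : Fin n, ExactCat.IsInjectiveFor (ExactCat.admissibleMono Ex) (X m.castSucc.succ)) →
      ExactCat.IsInjectiveFor (ExactCat.admissibleMono Ex) (X (Fin.last (n + 1)))) ↔
    -- there is `E ↣ I⁰ ⟶ ⋯ ⟶ Iⁿ⁻¹ ↠ Iⁿ` with all `Iᵐ = X (m + 1)` injective
    (∃ (X : Fin (n + 2) → C) (d : ∀ i : Fin (n + 1), X i.castSucc ⟶ X i.succ),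
      X 0 = E ∧ ExactCat.IsBoundedExactSequence Ex X d ∧
      ∀ m : Fin (n + 1), ExactCat.IsInjectiveFor (ExactCat.admissibleMono Ex) (X m.succ)) := by
  constructor
  · intro h
    obtain ⟨X, d, h₀, hX, hI⟩ := ExactCat.exists_isBoundedExactSequence hEx hinj n E
    refine ⟨X, d, h₀, hX, fun m => ?_⟩
    cases m using Fin.lastCases with
    | last => exact h X d h₀ hX hI
    | cast m => exact hI m
  · rintro ⟨X', d', h₀', hX', hI'⟩ X d h₀ hX hI
    exact hX.isInjectiveFor_last hEx hinj hX' (h₀.trans h₀'.symm) hI hI'
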